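/- For $n\in\mathbb{N}=\{0,1,2,\dots\}$ let $\mathcal{PB}_n$ be the partial Brauer monoid: its elements are the partitions of $[n]\cup[n]'$, where $[n]=\{1,\dots,n\}$ and $[n]'=\{1',\dots,n'\}$, into blocks of size at most $2$. The product $\alpha\beta$ is obtained by placing the diagram of $\alpha$ above that of $\beta$ and identifying each lower vertex of $\alpha$ with the corresponding upper vertex of $\beta$; two distinct vertices among the upper vertices of $\alpha$ and the lower vertices of $\beta$ then lie in the same block of $\alpha\beta$ if and only if they are connected by a path in the resulting graph. For $\alpha\in\mathcal{PB}_n$, the rank $\operatorname{rank}(\alpha)$ is the number of blocks of $\alpha$ meeting both $[n]$ and $[n]'$; the kernel $\ker(\alpha)$ (respectively, the cokernel $\operatorname{coker}(\alpha)$) is the equivalence relation on $[n]$ relating $x$ and $y$ if and only if $x,y$ (respectively, $x',y'$) lie in the same block of $\alpha$. The variant $\mathcal{PB}_n^{\alpha}$ is the semigroup with underlying set $\mathcal{PB}_n$ and operation $\xi\star_\alpha\eta=\xi\alpha\eta$. **Theorem.** Let $m,n\in\mathbb{N}$, and let $\alpha\in\mathcal{PB}_m$ and $\beta\in\mathcal{PB}_n$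 with $r=\operatorname{rank}(\alpha)\ge 1$ and $s=\operatorname{rank}(\beta)\ge 1$. Let $k$ and $l$ be the numbers of singleton classes of $\ker(\alpha)$ and $\ker(\beta)$, respectively, and let $p$ and $w$ be the numbers of singleton classes of $\operatorname{coker}(\alpha)$ and $\operatorname{coker}(\beta)$, respectively. Then $\mathcal{PB}_m^{\alpha}\cong\mathcal{PB}_n^{\beta}$ (as semigroups) if and only if $m=n$, $k=l$, $p=w$ and $r=s$. -/

import Mathlib

/-- A partial Brauer partition of degree `n`: a partition of `[n] ∪ [n]'` into blocks of size at
most 2, encoded as an equivalence relation on `Fin n ⊕ Fin n`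
(`Sum.inl i` is the upper vertex `i`, `Sum.inr i` is the lower vertex `i'`). -/
structure PartialBrauer (n : ℕ) where
  /-- `x` and `y` are related when they lie in the same block. -/
  rel : Setoid (Fin n ⊕ Fin n)
  /-- Every block has at most two elements. -/
  block_le_two : ∀ b ∈ rel.classes, b.ncard ≤ 2

namespace PartialBrauer

variable {n : ℕ}

/-- The diagram of `α`: distinct vertices in the same block are joined by an edge. -/
def diagram (α : PartialBrauer n) : SimpleGraph (Fin n ⊕ Fin n) where
  Adj x y := x ≠ y ∧ α.rel x y
  symm := ⟨fun _ _ h => ⟨h.1.symm, α.rel.symm h.2⟩⟩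
  loopless := ⟨fun _ h => h.1 rfl⟩

/-- The two rows of the diagram of the first factor are sent to the upper and middle rows. The three
rows are `Sum.inl i` (upper), `Sum.inr (Sum.inl i)` (middle) and `Sum.inr (Sum.inr i)` (lower). -/
def upperMiddle (n : ℕ) : (Fin n ⊕ Fin n) ↪ (Fin n ⊕ (Fin n ⊕ Fin n)) :=
  ⟨Sum.map id Sum.inl, Function.injective_id.sumMap Sum.inl_injective⟩

/-- The two rows of the diagram of the second factor are sent to the middle and lower rows. -/
def middleLower (n : ℕ) : (Fin n ⊕ Fin n) ↪ (Fin n ⊕ (Fin n ⊕ Fin n)) :=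
  ⟨Sum.inr, Sum.inr_injective⟩

/-- The two rows of the diagram of the product are the upper and lower rows. -/
def upperLower (n : ℕ) : (Fin n ⊕ Fin n) ↪ (Fin n ⊕ (Fin n ⊕ Fin n)) :=
  ⟨Sum.map id Sum.inr, Function.injective_id.sumMap Sum.inr_injective⟩

/-- The product diagram `Π(α, β)`: the lower row of `α` is identified with the upper row
of `β`. -/
def productDiagram (α β : PartialBrauer n) : SimpleGraph (Fin n ⊕ (Fin n ⊕ Fin n)) :=
  α.diagram.map (upperMiddle n) ⊔ β.diagram.map (middleLower n)

/-- Being connected by a path in the product diagram, for upper and lower vertices. -/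
def productRel (α β : PartialBrauer n) : Setoid (Fin n ⊕ Fin n) :=
  (productDiagram α β).reachableSetoid.comap (upperLower n)

/-- In the union of two matchings, a connected component contains at most two vertices that are
unmatched in one of the two matchings. -/
theorem eq_of_reachable_ends {V : Type*} {A B : SimpleGraph V}
    (hA : ∀ x y z, A.Adj x y → A.Adj x z → y = z) (hB : ∀ x y z, B.Adj x y → B.Adj x z → y = z)
    {x y z : V} (hx : (∀ w, ¬ A.Adj x w) ∨ (∀ w, ¬ B.Adj x w))
    (hy : (∀ w, ¬ A.Adj y w) ∨ (∀ w, ¬ B.Adj y w)) (hz : (∀ w, ¬ A.Adj z w) ∨ (∀ w, ¬ B.Adj z w))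
    (hxy : (A ⊔ B).Reachable x y) (hxz : (A ⊔ B).Reachable x z) :
    x = y ∨ x = z ∨ y = z := by
  classical
  obtain ⟨p, hp⟩ := hxy.exists_isPath
  have key : ∀ i, 0 < i → i < p.length →
      (A ⊔ B).Adj (p.getVert i) (p.getVert (i - 1)) ∧ (A ⊔ B).Adj (p.getVert i) (p.getVert (i + 1)) ∧
      p.getVert (i - 1) ≠ p.getVert (i + 1) := by
    intro i h0 hi
    refine ⟨?_, p.adj_getVert_succ hi, ?_⟩
    · have := p.adj_getVert_succ (i := i - 1) (by omega)
      rw [Nat.sub_add_cancel h0] at this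
      exact this.symm
    · intro h
      have := hp.getVert_injOn (by simp; omega) (by simp; omega) h
      omega
  have endU : ∀ e, ((∀ w, ¬ A.Adj e w) ∨ (∀ w, ¬ B.Adj e w)) → ∀ u v, (A ⊔ B).Adj e u →
      (A ⊔ B).Adj e v → u = v := by
    intro e he u v hu hv
    rw [SimpleGraph.sup_adj] at hu hv
    grind
  by_cases hxy' : x = y
  · exact Or.inl hxy'
  have hlen : 0 < p.length := by
    rcases Nat.eq_zero_or_pos p.length with h | h
    · exact absurd (SimpleGraph.Walk.eq_of_length_eq_zero h) hxy'
    · exact h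
  have closed : ∀ i, i ≤ p.length → ∀ w, (A ⊔ B).Adj (p.getVert i) w →
      ∃ j, j ≤ p.length ∧ p.getVert j = w := by
    intro i hi w hw
    rcases Nat.eq_zero_or_pos i with rfl | h0
    · refine ⟨1, hlen, ?_⟩
      have h1 := p.adj_getVert_succ hlen
      rw [SimpleGraph.Walk.getVert_zero] at hw h1
      exact endU x hx _ _ h1 hw
    rcases Nat.lt_or_ge i p.length with h1 | h1
    · obtain ⟨ha, hb, hne⟩ := key i h0 h1
      rw [SimpleGraph.sup_adj] at ha hb hw
      by_cases e : p.getVert (i - 1) = w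
      · exact ⟨i - 1, by omega, e⟩
      · refine ⟨i + 1, h1, ?_⟩
        grind
    · obtain rfl : i = p.length := by omega
      refine ⟨p.length - 1, by omega, ?_⟩
      have h2 := p.adj_getVert_succ (i := p.length - 1) (by omega)
      rw [Nat.sub_add_cancel hlen, SimpleGraph.Walk.getVert_length] at h2
      rw [SimpleGraph.Walk.getVert_length] at hw
      exact endU y hy _ _ h2.symm hw
  have hall : ∀ {u v : V}, (A ⊔ B).Walk u v → (∃ i, i ≤ p.length ∧ p.getVert i = u) →
      ∃ i, i ≤ p.length ∧ p.getVert i = v := by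
    intro u v q
    induction q with
    | nil => exact id
    | cons h q ih =>
      rintro ⟨i, hi, rfl⟩
      exact ih (closed i hi _ h)
  obtain ⟨q⟩ := hxz
  obtain ⟨i, hi, hiz⟩ := hall q ⟨0, Nat.zero_le _, p.getVert_zero⟩
  rcases Nat.eq_zero_or_pos i with rfl | h0
  · exact Or.inr (Or.inl (by rw [← hiz, p.getVert_zero]))
  rcases Nat.lt_or_ge i p.length with h1 | h1
  · obtain ⟨ha, hb, hne⟩ := key i h0 h1
    rw [hiz] at ha hb
    exact absurd (endU z hz _ _ ha hb) hne
  · obtain rfl : i = p.length := by omega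
    exact Or.inr (Or.inr (by rw [← hiz, p.getVert_length]))

theorem diagram_matching (α : PartialBrauer n) (x y z : Fin n ⊕ Fin n)
    (hy : α.diagram.Adj x y) (hz : α.diagram.Adj x z) : y = z := by
  by_contra hne
  have h := α.block_le_two _ (α.rel.mem_classes x)
  have hsub : ({x, y, z} : Set (Fin n ⊕ Fin n)) ⊆ {w | α.rel w x} := by
    rintro w (rfl | rfl | rfl)
    · exact α.rel.refl _
    · exact α.rel.symm hy.2
    · exact α.rel.symm hz.2
  have h3 := Set.ncard_le_ncard hsub (Set.toFinite _)
  rw [Set.ncard_eq_three.mpr ⟨x, y, z, hy.1, hz.1, hne, rfl⟩] at h3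
  omega

theorem map_matching {V W : Type*} (G : SimpleGraph V) (f : V ↪ W)
    (h : ∀ x y z, G.Adj x y → G.Adj x z → y = z) (x y z : W)
    (hy : (G.map f).Adj x y) (hz : (G.map f).Adj x z) : y = z := by
  obtain ⟨a, b, hab, rfl, rfl⟩ := (SimpleGraph.map_adj f G x y).mp hy
  obtain ⟨c, d, hcd, hc, rfl⟩ := (SimpleGraph.map_adj f G (f a) z).mp hz
  obtain rfl := f.injective hc
  rw [h _ _ _ hab hcd]

theorem productRel_block_le_two (α β : PartialBrauer n) :
    ∀ b ∈ (productRel α β).classes, b.ncard ≤ 2 := by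
  have hend : ∀ x, (∀ w, ¬ (α.diagram.map (upperMiddle n)).Adj (upperLower n x) w) ∨
      (∀ w, ¬ (β.diagram.map (middleLower n)).Adj (upperLower n x) w) := by
    rintro (i | i)
    · right
      intro w hw
      obtain ⟨a, b, -, ha, -⟩ := (SimpleGraph.map_adj _ _ _ _).mp hw
      simp [middleLower, upperLower] at ha
    · left
      intro w hw
      obtain ⟨a, b, -, ha, -⟩ := (SimpleGraph.map_adj _ _ _ _).mp hw
      rcases a with a | a <;> simp [upperMiddle, upperLower] at ha
  rintro _ ⟨x, rfl⟩
  by_contra! hlt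
  obtain ⟨a, ha, b, hb, c, hc, hab, hac, hbc⟩ := (Set.two_lt_ncard (Set.toFinite _)).mp hlt
  have h1 : (productRel α β) a b := (productRel α β).trans ha ((productRel α β).symm hb)
  have h2 : (productRel α β) a c := (productRel α β).trans ha ((productRel α β).symm hc)
  have := eq_of_reachable_ends (map_matching _ (upperMiddle n) α.diagram_matching)
    (map_matching _ (middleLower n) β.diagram_matching) (hend a) (hend b) (hend c) h1 h2
  simp only [(upperLower n).injective.eq_iff] at this
  tauto

/-- The product of the partial Brauer monoid `PB_n`: two vertices are in the same block of `α * β`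
if and only if they are connected by a path in the product diagram. -/
instance : Mul (PartialBrauer n) where
  mul α β := ⟨productRel α β, productRel_block_le_two α β⟩

/-- The rank: the number of transversals, i.e. of blocks that contain both an upper and a lower
vertex. -/
noncomputable def rank (α : PartialBrauer n) : ℕ :=
  {b ∈ α.rel.classes | (∃ i, Sum.inl i ∈ b) ∧ (∃ j, Sum.inr j ∈ b)}.ncard

/-- The kernel: upper vertices in the same block. -/
def ker (α : PartialBrauer n) : Setoid (Fin n) := α.rel.comap Sum.inl

/-- The cokernel: lower vertices in the same block. -/
def coker (α : PartialBrauer n) : Setoid (Fin n) := α.rel.comap Sum.inr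

end PartialBrauer

/-- The number of singleton classes of an equivalence relation on a finite set. -/
noncomputable def numSingletonClasses {X : Type*} [Finite X] (r : Setoid X) : ℕ :=
  {c ∈ r.classes | c.ncard = 1}.ncard

/-- The underlying set of the variant `S^a` of `S` with sandwich element `a`. -/
def Variant {S : Type*} [Mul S] (_a : S) : Type _ := S

/-- The sandwich product `x ⋆ y = x a y` of the variant `S^a`. -/
instance {S : Type*} [Mul S] (a : S) : Mul (Variant a) where
  mul := fun (x y : S) => (x * a * y : S)

/-! Renaming the two rows of the sandwich element independently does not change the variant
(`nonempty_variant_relabel`), and every diagram can be renamed to a standard one with `r` vertical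
transversals, `h` upper hooks and `h'` lower hooks, where `k + 2h = n` and `p + 2h' = n`
(`exists_relabel_eq_standard`). So equal parameters give isomorphic variants.

Conversely, the parameters are recovered by counting. The size of the underlying set determines the
degree. Because the ambient semigroup has an identity, the relations `xa = ya`, `axa = aya` and `axa
= a` can be expressed inside the variant, so an isomorphism preserves them. Hence `|aSa|` is an
invariant; it equals `|eSe|` for an idempotent `e` of the same rank and grows strictly with the rank
(`rank_eq_of_variant_standard`). The number of preinverses of `a` modulo `xa = ya` is also an
invariant; it depends only on `r` and `h'` and, for `r ≥ 1`, grows strictly with `h'`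
(`lower_eq_of_variant_standard`). The upper hooks follow by flipping diagrams.

Products are computed through colourings: a diagram is determined by the Boolean colourings constant
on its blocks, and for these, multiplication is composition of relations (`compatible_mul`). -/

theorem nonempty_variant_mulEquiv_iff {S T : Type*} [Mul S] [Mul T] (a : S) (b : T) :
    Nonempty (Variant a ≃* Variant b) ↔
      ∃ φ : S ≃ T, ∀ x y, φ (x * a * y) = φ x * b * φ y :=
  ⟨fun ⟨φ⟩ => ⟨φ.toEquiv, fun x y => φ.map_mul' x y⟩,
    fun ⟨φ, h⟩ => ⟨{ toEquiv := (φ : Variant a ≃ Variant b), map_mul' := fun x y => h x y }⟩⟩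

/-! ### Boolean colourings and the monoid structure -/

namespace PartialBrauer

variable {n : ℕ}

@[ext]
theorem ext_rel {α β : PartialBrauer n} (h : ∀ x y, α.rel x y ↔ β.rel x y) : α = β := by
  cases α
  cases β
  congr
  exact Setoid.ext h

theorem eq_or_eq_or_eq (α : PartialBrauer n) {x y z : Fin n ⊕ Fin n} (hy : α.rel x y)
    (hz : α.rel x z) : x = y ∨ x = z ∨ y = z := by
  by_contra! h
  exact h.2.2 (α.diagram_matching x y z ⟨h.1, hy⟩ ⟨h.2.1, hz⟩)

/-- A partial Brauer partition from an equivalence relation without three related points. -/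
def ofSetoid (s : Setoid (Fin n ⊕ Fin n))
    (h : ∀ x y z, s x y → s x z → x = y ∨ x = z ∨ y = z) : PartialBrauer n where
  rel := s
  block_le_two := by
    rintro _ ⟨x, rfl⟩
    by_contra! hlt
    obtain ⟨a, ha, b, hb, c, hc, hab, hac, hbc⟩ := (Set.two_lt_ncard (Set.toFinite _)).mp hlt
    have := h a b c (s.trans ha (s.symm hb)) (s.trans ha (s.symm hc))
    tauto

instance : Finite (PartialBrauer n) :=
  Finite.of_injective (fun α : PartialBrauer n => fun x y => α.rel x y)
    fun _ _ h => ext_rel fun x y => iff_of_eq (congrFun (congrFun h x) y)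

/-- A colouring of the vertices is compatible with `α` when it is constant on blocks. -/
def Compatible (α : PartialBrauer n) (f : Fin n ⊕ Fin n → Bool) : Prop :=
  ∀ x y, α.rel x y → f x = f y

/-- The indicator function of the `α`-block of `x` is itself a compatible colouring, so colourings
separate blocks. -/
theorem rel_of_compatible {α β : PartialBrauer n} (h : ∀ f, α.Compatible f → β.Compatible f)
    {x y : Fin n ⊕ Fin n} (hxy : β.rel x y) : α.rel x y := by
  classical
  have := h (fun z => decide (α.rel x z)) (by
    intro u v huv
    have : α.rel x u ↔ α.rel x v := ⟨fun h => α.rel.trans h huv, fun h => α.rel.trans h (α.rel.symm huv)⟩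
    simp [this]) x y hxy
  simpa [α.rel.refl x] using this

theorem ext_compatible {α β : PartialBrauer n}
    (h : ∀ f g, α.Compatible (Sum.elim f g) ↔ β.Compatible (Sum.elim f g)) : α = β := by
  have h' : ∀ f, α.Compatible f ↔ β.Compatible f := fun f => by
    rw [← Sum.elim_comp_inl_inr f]
    exact h _ _
  exact ext_rel fun x y => ⟨rel_of_compatible fun f => (h' f).2, rel_of_compatible fun f => (h' f).1⟩

theorem mul_rel (α β : PartialBrauer n) (x y : Fin n ⊕ Fin n) :
    (α * β).rel x y ↔ (productDiagram α β).Reachable (upperLower n x) (upperLower n y) :=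
  Iff.rfl

theorem productDiagram_reachable_left (α β : PartialBrauer n) {x y : Fin n ⊕ Fin n}
    (h : α.rel x y) : (productDiagram α β).Reachable (upperMiddle n x) (upperMiddle n y) := by
  by_cases hxy : x = y
  · rw [hxy]
  · refine SimpleGraph.Adj.reachable (Or.inl ?_)
    exact (SimpleGraph.map_adj _ _ _ _).2 ⟨x, y, ⟨hxy, h⟩, rfl, rfl⟩

theorem productDiagram_reachable_right (α β : PartialBrauer n) {x y : Fin n ⊕ Fin n}
    (h : β.rel x y) : (productDiagram α β).Reachable (middleLower n x) (middleLower n y) := by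
  by_cases hxy : x = y
  · rw [hxy]
  · refine SimpleGraph.Adj.reachable (Or.inr ?_)
    exact (SimpleGraph.map_adj _ _ _ _).2 ⟨x, y, ⟨hxy, h⟩, rfl, rfl⟩

theorem compatible_mul (α β : PartialBrauer n) (f g : Fin n → Bool) :
    (α * β).Compatible (Sum.elim f g) ↔
      ∃ h, α.Compatible (Sum.elim f h) ∧ β.Compatible (Sum.elim h g) := by
  classical
  constructor
  · intro hc
    let G := productDiagram α β
    -- Colour a component `true` when it contains an outer vertex coloured `true`; components
    -- confined to the middle row get `false`.
    let c : Fin n ⊕ (Fin n ⊕ Fin n) → Bool := fun v =>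
      decide (∃ x, G.Reachable (upperLower n x) v ∧ Sum.elim f g x = true)
    have hcc : ∀ u v, G.Reachable u v → c u = c v := by
      intro u v huv
      have : (∃ x, G.Reachable (upperLower n x) u ∧ Sum.elim f g x = true) ↔
          ∃ x, G.Reachable (upperLower n x) v ∧ Sum.elim f g x = true :=
        ⟨fun ⟨x, h, h'⟩ => ⟨x, h.trans huv, h'⟩, fun ⟨x, h, h'⟩ => ⟨x, h.trans huv.symm, h'⟩⟩
      simp only [c, this]
    have hend : ∀ x, c (upperLower n x) = Sum.elim f g x := by
      intro x
      rw [Bool.eq_iff_iff]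
      simp only [c, decide_eq_true_eq]
      constructor
      · rintro ⟨y, hy, h⟩
        rw [← h]
        exact ((hc y x) hy).symm
      · exact fun h => ⟨x, SimpleGraph.Reachable.refl _, h⟩
    refine ⟨fun i => c (Sum.inr (Sum.inl i)), ?_, ?_⟩
    · have key : ∀ x, Sum.elim f (fun i => c (Sum.inr (Sum.inl i))) x = c (upperMiddle n x) := by
        rintro (i | i)
        · exact (hend (Sum.inl i)).symm
        · rfl
      intro x y h
      rw [key, key]
      exact hcc _ _ (productDiagram_reachable_left α β h)
    · have key : ∀ x, Sum.elim (fun i => c (Sum.inr (Sum.inl i))) g x = c (middleLower n x) := by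
        rintro (i | i)
        · rfl
        · exact (hend (Sum.inr i)).symm
      intro x y h
      rw [key, key]
      exact hcc _ _ (productDiagram_reachable_right α β h)
  · rintro ⟨h, hα, hβ⟩
    let c : Fin n ⊕ (Fin n ⊕ Fin n) → Bool := Sum.elim f (Sum.elim h g)
    have hadj : ∀ u v, (productDiagram α β).Adj u v → c u = c v := by
      rintro u v (h1 | h1)
      · obtain ⟨a, b, hab, rfl, rfl⟩ := (SimpleGraph.map_adj _ _ _ _).1 h1
        have := hα a b hab.2
        rcases a with a | a <;> rcases b with b | b <;> simpa [c, upperMiddle] using this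
      · obtain ⟨a, b, hab, rfl, rfl⟩ := (SimpleGraph.map_adj _ _ _ _).1 h1
        exact hβ a b hab.2
    have hwalk : ∀ u v, (productDiagram α β).Walk u v → c u = c v := by
      intro u v p
      induction p with
      | nil => rfl
      | cons h _ ih => exact (hadj _ _ h).trans ih
    intro x y hxy
    obtain ⟨p⟩ := (mul_rel α β x y).1 hxy
    have := hwalk _ _ p
    rcases x with a | a <;> rcases y with b | b <;> simpa [c, upperLower] using this

instance : One (PartialBrauer n) where
  one := ofSetoid (Setoid.ker (Sum.elim id id)) (by
    rintro (x | x) (y | y) (z | z) h h' <;> simp_all [Setoid.ker_def])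

theorem compatible_one (f g : Fin n → Bool) :
    (1 : PartialBrauer n).Compatible (Sum.elim f g) ↔ f = g := by
  constructor
  · exact fun h => funext fun i => h (Sum.inl i) (Sum.inr i) rfl
  · rintro rfl (x | x) (y | y) h <;> exact congrArg f h

instance : Monoid (PartialBrauer n) where
  mul_assoc a b c := by
    refine ext_compatible fun f g => ?_
    simp only [compatible_mul]
    constructor
    · rintro ⟨h, ⟨h', h1, h2⟩, h3⟩
      exact ⟨h', h1, h, h2, h3⟩
    · rintro ⟨h, h1, h', h2, h3⟩
      exact ⟨h', ⟨h, h1, h2⟩, h3⟩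
  one_mul a := ext_compatible fun f g => by simp [compatible_mul, compatible_one]
  mul_one a := ext_compatible fun f g => by simp [compatible_mul, compatible_one]

/-! ### Symmetries: renaming vertices and exchanging rows -/

/-- Renaming the upper and lower vertices. -/
def relabel (π ρ : Equiv.Perm (Fin n)) (α : PartialBrauer n) : PartialBrauer n :=
  ofSetoid (α.rel.comap (Sum.map π ρ)) fun x y z hy hz => by
    have hinj : Function.Injective (Sum.map π ρ) := π.injective.sumMap ρ.injective
    have := α.eq_or_eq_or_eq hy hz
    simpa only [hinj.eq_iff] using this

theorem relabel_rel (π ρ : Equiv.Perm (Fin n)) (α : PartialBrauer n) (x y : Fin n ⊕ Fin n) :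
    (relabel π ρ α).rel x y ↔ α.rel (Sum.map π ρ x) (Sum.map π ρ y) :=
  Iff.rfl

theorem relabel_relabel (π ρ π' ρ' : Equiv.Perm (Fin n)) (α : PartialBrauer n) :
    relabel π ρ (relabel π' ρ' α) = relabel (π' * π) (ρ' * ρ) α := by
  ext x y
  rcases x with x | x <;> rcases y with y | y <;> simp [relabel_rel]

theorem relabel_one (α : PartialBrauer n) : relabel 1 1 α = α := by
  ext x y
  rcases x with x | x <;> rcases y with y | y <;> simp [relabel_rel]

theorem compatible_relabel (π ρ : Equiv.Perm (Fin n)) (α : PartialBrauer n)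
    (f g : Fin n → Bool) : (relabel π ρ α).Compatible (Sum.elim (f ∘ π) (g ∘ ρ)) ↔
      α.Compatible (Sum.elim f g) := by
  rw [← Sum.elim_comp_map]
  constructor
  · intro h x y hxy
    have := h (Sum.map π.symm ρ.symm x) (Sum.map π.symm ρ.symm y) (by
      rw [relabel_rel]
      simpa [Sum.map_map] using hxy)
    simpa [Sum.map_map] using this
  · exact fun h x y hxy => h _ _ hxy

theorem relabel_mul (π ρ τ : Equiv.Perm (Fin n)) (α β : PartialBrauer n) :
    relabel π τ (α * β) = relabel π ρ α * relabel ρ τ β := by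
  refine ext_compatible fun f g => ?_
  obtain ⟨f, rfl⟩ : ∃ f', f = f' ∘ π := ⟨f ∘ π.symm, by ext; simp⟩
  obtain ⟨g, rfl⟩ : ∃ g', g = g' ∘ τ := ⟨g ∘ τ.symm, by ext; simp⟩
  rw [compatible_relabel, compatible_mul, compatible_mul]
  constructor
  · rintro ⟨h, h1, h2⟩
    exact ⟨h ∘ ρ, (compatible_relabel _ _ _ _ _).2 h1, (compatible_relabel _ _ _ _ _).2 h2⟩
  · rintro ⟨h, h1, h2⟩
    obtain ⟨h, rfl⟩ : ∃ h', h = h' ∘ ρ := ⟨h ∘ ρ.symm, by ext; simp⟩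
    exact ⟨h, (compatible_relabel _ _ _ _ _).1 h1, (compatible_relabel _ _ _ _ _).1 h2⟩

/-- Renaming the vertices of the sandwich element does not change the variant. -/
theorem nonempty_variant_relabel (π ρ : Equiv.Perm (Fin n)) (α : PartialBrauer n) :
    Nonempty (Variant α ≃* Variant (relabel π ρ α)) := by
  -- The roles of `π` and `ρ` are exchanged on the elements: in `x * α * y` the lower row of `x`
  -- meets the upper row of `α`, and the upper row of `y` meets its lower row.
  refine (nonempty_variant_mulEquiv_iff _ _).2
    ⟨⟨relabel ρ π, relabel ρ⁻¹ π⁻¹, fun x => ?_, fun x => ?_⟩, fun x y => ?_⟩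
  · simp [relabel_relabel, relabel_one]
  · simp [relabel_relabel, relabel_one]
  · change relabel ρ π (x * α * y) = relabel ρ π x * relabel π ρ α * relabel ρ π y
    rw [relabel_mul ρ ρ π, relabel_mul ρ π ρ]

/-- Exchanging the two rows. -/
def flip (α : PartialBrauer n) : PartialBrauer n :=
  ofSetoid (α.rel.comap Sum.swap) fun x y z hy hz => by
    have := α.eq_or_eq_or_eq hy hz
    simpa only [Sum.swap_leftInverse.injective.eq_iff] using this

theorem flip_rel (α : PartialBrauer n) (x y : Fin n ⊕ Fin n) :
    (flip α).rel x y ↔ α.rel x.swap y.swap :=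
  Iff.rfl

theorem flip_flip (α : PartialBrauer n) : flip (flip α) = α := by
  ext x y
  simp [flip_rel]

theorem compatible_flip (α : PartialBrauer n) (f g : Fin n → Bool) :
    (flip α).Compatible (Sum.elim f g) ↔ α.Compatible (Sum.elim g f) := by
  have key : ∀ x, Sum.elim f g x = Sum.elim g f x.swap := by rintro (x | x) <;> rfl
  constructor
  · intro h x y hxy
    have := h x.swap y.swap (by simpa [flip_rel] using hxy)
    simpa [key] using this
  · intro h x y hxy
    rw [key, key]
    exact h _ _ hxy

theorem flip_mul (α β : PartialBrauer n) : flip (α * β) = flip β * flip α := by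
  refine ext_compatible fun f g => ?_
  simp only [compatible_flip, compatible_mul]
  exact exists_congr fun _ => and_comm

/-- An isomorphism of variants yields one of the variants at the flipped elements. -/
theorem nonempty_variant_flip {α β : PartialBrauer n} (h : Nonempty (Variant α ≃* Variant β)) :
    Nonempty (Variant (flip α) ≃* Variant (flip β)) := by
  obtain ⟨φ, hφ⟩ := (nonempty_variant_mulEquiv_iff _ _).1 h
  -- Conjugating by the anti-automorphism `flip` reverses products twice, so the result is again
  -- multiplicative.
  refine (nonempty_variant_mulEquiv_iff _ _).2
    ⟨⟨fun x => flip (φ (flip x)), fun x => flip (φ.symm (flip x)), fun x => ?_, fun x => ?_⟩,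
      fun x y => ?_⟩
  · simp [flip_flip]
  · simp [flip_flip]
  · change flip (φ (flip (x * flip α * y))) =
      flip (φ (flip x)) * flip β * flip (φ (flip y))
    rw [flip_mul, flip_mul, flip_flip, ← mul_assoc, hφ, flip_mul, flip_mul, mul_assoc]

end PartialBrauer

/-! ### Invariants of variants of a monoid -/

theorem ncard_image_congr {S T A B : Type*} [Finite S] [Finite T] (φ : S ≃ T) {s : Set S}
    {t : Set T} {f : S → A} {g : T → B} (hst : ∀ x, x ∈ s ↔ φ x ∈ t)
    (hfg : ∀ x y, f x = f y ↔ g (φ x) = g (φ y)) : (f '' s).ncard = (g '' t).ncard := by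
  have hs : ∀ a : f '' s, ∃ x ∈ s, f x = a := fun a => a.2
  choose k hk hk' using hs
  refine Set.ncard_congr (fun a ha => g (φ (k ⟨a, ha⟩))) ?_ ?_ ?_
  · exact fun a ha => ⟨_, (hst _).1 (hk _), rfl⟩
  · intro a b ha hb h
    rw [← hfg, hk', hk'] at h
    exact h
  · rintro _ ⟨y, hy, rfl⟩
    have hy' : φ.symm y ∈ s := by rw [hst]; simpa using hy
    refine ⟨f (φ.symm y), ⟨_, hy', rfl⟩, ?_⟩
    have := (hfg _ _).1 (hk' ⟨f (φ.symm y), ⟨_, hy', rfl⟩⟩)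
    simpa using this

section Sandwich

variable {S T : Type*} [Monoid S] [Monoid T]

/-- `x * a = y * a` says that `x` and `y` act alike by left multiplication in the variant: test
against all `v`, in particular `v = 1`. Surjectivity of `φ` transfers the quantifier. -/
theorem sandwich_eq_iff {a : S} {b : T} (φ : S ≃ T)
    (hφ : ∀ x y, φ (x * a * y) = φ x * b * φ y) (x y : S) :
    x * a = y * a ↔ φ x * b = φ y * b := by
  have hS : x * a = y * a ↔ ∀ v, x * a * v = y * a * v :=
    ⟨fun h v => by rw [h], fun h => by simpa using h 1⟩
  have hT : φ x * b = φ y * b ↔ ∀ v, φ x * b * v = φ y * b * v :=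
    ⟨fun h v => by rw [h], fun h => by simpa using h 1⟩
  rw [hS, hT, ← φ.forall_congr_right]
  simp only [← hφ, φ.injective.eq_iff]

theorem sandwich_sandwich_eq_iff {a : S} {b : T} (φ : S ≃ T)
    (hφ : ∀ x y, φ (x * a * y) = φ x * b * φ y) (x y : S) :
    a * x * a = a * y * a ↔ b * φ x * b = b * φ y * b := by
  have hS : a * x * a = a * y * a ↔ ∀ u, u * a * x * a = u * a * y * a :=
    ⟨fun h u => by simpa only [mul_assoc] using congrArg (u * ·) h, fun h => by simpa using h 1⟩
  have hT : b * φ x * b = b * φ y * b ↔ ∀ u, u * b * φ x * b = u * b * φ y * b :=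
    ⟨fun h u => by simpa only [mul_assoc] using congrArg (u * ·) h, fun h => by simpa using h 1⟩
  rw [hS, hT, ← φ.forall_congr_right]
  simp only [← hφ]
  exact forall_congr' fun u => sandwich_eq_iff φ hφ _ _

/-- The equation says that `u * a * x` and `u` agree after right multiplication by `a` for every
`u`, which `sandwich_eq_iff` transfers. -/
theorem preinverse_iff {a : S} {b : T} (φ : S ≃ T)
    (hφ : ∀ x y, φ (x * a * y) = φ x * b * φ y) (x : S) :
    a * x * a = a ↔ b * φ x * b = b := by
  have hS : a * x * a = a ↔ ∀ u, u * a * x * a = u * a :=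
    ⟨fun h u => by simpa only [mul_assoc] using congrArg (u * ·) h, fun h => by simpa using h 1⟩
  have hT : b * φ x * b = b ↔ ∀ u, u * b * φ x * b = u * b :=
    ⟨fun h u => by simpa only [mul_assoc] using congrArg (u * ·) h, fun h => by simpa using h 1⟩
  rw [hS, hT, ← φ.forall_congr_right]
  simp only [← hφ]
  exact forall_congr' fun u => sandwich_eq_iff φ hφ _ _

/-- The size of `aSa` only depends on an idempotent of the `𝒟`-class of `a`. -/
theorem ncard_range_sandwich {a e : S} (ha : a * e * a = a) (he : e * a * e = e) :
    (Set.range fun x => a * x * a).ncard = (Set.range fun x => e * x * e).ncard := by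
  refine Set.ncard_congr (fun y _ => e * y * e) ?_ ?_ ?_
  -- The inverse map is `z ↦ a * z * a`.
  · exact fun y _ => ⟨y, rfl⟩
  · rintro _ _ ⟨x, rfl⟩ ⟨y, rfl⟩ h
    have := congrArg (fun z => a * z * a) h
    simp only at this
    have key : ∀ x, a * (e * (a * x * a) * e) * a = a * x * a := fun x => by
      calc _ = a * e * a * x * (a * e * a) := by simp only [mul_assoc]
        _ = _ := by rw [ha]
    rwa [key, key] at this
  · rintro _ ⟨x, rfl⟩
    refine ⟨a * (e * x * e) * a, ⟨_, rfl⟩, ?_⟩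
    calc _ = e * a * e * x * (e * a * e) := by simp only [mul_assoc]
      _ = _ := by rw [he]

/-- Preinverses of `a`, up to the congruence of right multiplication by `a`, correspond to right
inverses of `e * a` over the idempotent `e`. -/
theorem ncard_image_preinverse {a e : S} (ha : a * e * a = a) (he : e * a * e = e)
    (hee : e * e = e) :
    ((fun x => x * a) '' {x | a * x * a = a}).ncard = {y | y * e = y ∧ e * a * y = e}.ncard := by
  refine Set.ncard_congr (fun y _ => y * e) ?_ ?_ ?_
  · rintro _ ⟨x, hx, rfl⟩
    refine ⟨by rw [mul_assoc, hee], ?_⟩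
    calc e * a * (x * a * e) = e * (a * x * a) * e := by simp only [mul_assoc]
      _ = e := by rw [hx, he]
  · rintro _ _ ⟨x, -, rfl⟩ ⟨y, -, rfl⟩ h
    have := congrArg (· * a) h
    have key : ∀ x, x * a * e * a = x * a := fun x => by
      calc x * a * e * a = x * (a * e * a) := by simp only [mul_assoc]
        _ = _ := by rw [ha]
    simpa only [key] using this
  · rintro y ⟨hy, hy'⟩
    -- Right multiplication by `a` is the inverse map, and `y` is itself a preinverse of `a`.
    refine ⟨y * a, ⟨y, ?_, rfl⟩, ?_⟩
    · calc a * y * a = a * e * a * y * a := by rw [ha]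
        _ = a * (e * a * y) * a := by simp only [mul_assoc]
        _ = a := by rw [hy', ha]
    · calc y * a * e = y * e * a * e := by rw [hy]
        _ = y * (e * a * e) := by simp only [mul_assoc]
        _ = y := by rw [he, hy]

end Sandwich

/-! ### Diagrams in standard position -/

namespace PartialBrauer

variable {n : ℕ}

/-- Labels of the vertices of a row: the first `r` vertices carry transversals, the next `2 * h`
vertices carry consecutive hooks, the others are isolated. -/
def rowLabel (r h c x : ℕ) : ℕ × ℕ :=
  if x < r then (0, x) else if x < r + 2 * h then (c, (x - r) / 2) else (c + 1, x)

theorem rowLabel_eq_iff {r h c x y : ℕ} (hc : 0 < c) : rowLabel r h c x = rowLabel r h c y ↔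
    x = y ∨ (r ≤ x ∧ x < r + 2 * h ∧ r ≤ y ∧ y < r + 2 * h ∧ (x - r) / 2 = (y - r) / 2) := by
  unfold rowLabel
  split_ifs <;> simp only [Prod.mk.injEq, true_and] <;> omega

/-- Offset `1` uses the tags 1 and 2, offset `3` the tags 3 and 4, so the two rows share only the
transversal tag 0. -/
theorem rowLabel_eq_rowLabel_iff {r h h' x y : ℕ} :
    rowLabel r h 1 x = rowLabel r h' 3 y ↔ x = y ∧ x < r := by
  unfold rowLabel
  split_ifs <;> simp only [Prod.mk.injEq, true_and] <;> omega

/-- The diagram with `r` vertical transversals, `h` upper hooks and `h'` lower hooks in standard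
position. -/
def standard (n r h h' : ℕ) : PartialBrauer n :=
  ofSetoid (Setoid.ker (Sum.elim (fun x : Fin n => rowLabel r h 1 x)
    fun x : Fin n => rowLabel r h' 3 x)) (by
    rintro (x | x) (y | y) (z | z) hy hz <;>
    simp only [Setoid.ker_def, Sum.elim_inl, Sum.elim_inr, rowLabel_eq_iff, zero_lt_one,
      Nat.ofNat_pos, rowLabel_eq_rowLabel_iff, eq_comm (a := rowLabel r h' 3 _)
      (b := rowLabel r h 1 _), Sum.inl.injEq, Sum.inr.injEq, Fin.ext_iff, reduceCtorEq] at hy hz ⊢ <;>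
    omega)

theorem standard_rel_inl_inl {r h h' : ℕ} {x y : Fin n} :
    (standard n r h h').rel (Sum.inl x) (Sum.inl y) ↔ rowLabel r h 1 x = rowLabel r h 1 y :=
  Iff.rfl

theorem standard_rel_inr_inr {r h h' : ℕ} {x y : Fin n} :
    (standard n r h h').rel (Sum.inr x) (Sum.inr y) ↔ rowLabel r h' 3 x = rowLabel r h' 3 y :=
  Iff.rfl

theorem standard_rel_inl_inr {r h h' : ℕ} {x y : Fin n} :
    (standard n r h h').rel (Sum.inl x) (Sum.inr y) ↔ x = y ∧ (x : ℕ) < r := by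
  rw [Fin.ext_iff]
  exact rowLabel_eq_rowLabel_iff

/-- A colouring of a row is compatible with the hooks in standard position. -/
def RowCompatible (r h : ℕ) (f : Fin n → Bool) : Prop :=
  ∀ i j : Fin n, r ≤ i → i < r + 2 * h → r ≤ j → j < r + 2 * h →
    ((i : ℕ) - r) / 2 = (j - r) / 2 → f i = f j

theorem RowCompatible.mono {r h h' : ℕ} {f : Fin n → Bool} (hf : RowCompatible r h' f)
    (hh : h ≤ h') : RowCompatible r h f :=
  fun i j h1 h2 h3 h4 h5 => hf i j h1 (by omega) h3 (by omega) h5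

theorem rowCompatible_of_false {r : ℕ} (h : ℕ) {f : Fin n → Bool}
    (hf : ∀ i : Fin n, r ≤ i → f i = false) : RowCompatible r h f :=
  fun i j h1 _ h3 _ _ => by rw [hf i h1, hf j h3]

theorem rowCompatible_zero {r : ℕ} {f : Fin n → Bool} : RowCompatible r 0 f :=
  fun i j h1 h2 => by omega

theorem compatible_standard {r h h' : ℕ} {f g : Fin n → Bool} :
    (standard n r h h').Compatible (Sum.elim f g) ↔
      (∀ i : Fin n, (i : ℕ) < r → f i = g i) ∧ RowCompatible r h f ∧ RowCompatible r h' g := by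
  constructor
  · refine fun hc => ⟨fun i hi => hc (Sum.inl i) (Sum.inr i) ?_, ?_, ?_⟩
    · exact standard_rel_inl_inr.2 ⟨rfl, hi⟩
    · intro i j h1 h2 h3 h4 h5
      refine hc (Sum.inl i) (Sum.inl j) ?_
      rw [standard_rel_inl_inl, rowLabel_eq_iff one_pos]
      omega
    · intro i j h1 h2 h3 h4 h5
      refine hc (Sum.inr i) (Sum.inr j) ?_
      rw [standard_rel_inr_inr, rowLabel_eq_iff (by norm_num)]
      omega
  · rintro ⟨h1, h2, h3⟩ (x | x) (y | y) hxy
    · rw [standard_rel_inl_inl, rowLabel_eq_iff one_pos, ← Fin.ext_iff] at hxy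
      rcases hxy with rfl | ⟨a, b, c, d, e⟩
      exacts [rfl, h2 _ _ a b c d e]
    · obtain ⟨rfl, hx⟩ := standard_rel_inl_inr.1 hxy
      exact h1 _ hx
    · obtain ⟨rfl, hx⟩ := standard_rel_inl_inr.1 ((standard n r h h').rel.symm hxy)
      exact (h1 _ hx).symm
    · rw [standard_rel_inr_inr, rowLabel_eq_iff (by norm_num), ← Fin.ext_iff] at hxy
      rcases hxy with rfl | ⟨a, b, c, d, e⟩
      exacts [rfl, h3 _ _ a b c d e]

/-- Middle vertices from position `r` on are never connected to the outer rows, so the inner hooks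
vanish. Consequently `standard n r 0 0` is idempotent and is an inverse of each `standard n r h h'`.
-/
theorem standard_mul_standard (n r h₁ h₂ h₃ h₄ : ℕ) :
    standard n r h₁ h₂ * standard n r h₃ h₄ = standard n r h₁ h₄ := by
  refine ext_compatible fun f g => ?_
  simp only [compatible_mul, compatible_standard]
  constructor
  · rintro ⟨m, ⟨a, b, -⟩, c, -, d⟩
    exact ⟨fun i hi => (a i hi).trans (c i hi), b, d⟩
  · rintro ⟨a, b, c⟩
    have hm : ∀ i : Fin n, r ≤ i → (if (i : ℕ) < r then f i else false) = false :=
      fun i hi => if_neg (by omega)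
    refine ⟨fun i => if (i : ℕ) < r then f i else false, ⟨fun i hi => (if_pos hi).symm, b, ?_⟩,
      fun i hi => (if_pos hi).trans (a i hi), ?_, c⟩
    all_goals exact rowCompatible_of_false _ hm

theorem standard_mul_standard_of_le {r s : ℕ} (hrs : r ≤ s) :
    standard n r 0 0 * standard n s 0 0 = standard n r 0 0 := by
  refine ext_compatible fun f g => ?_
  simp only [compatible_mul, compatible_standard, rowCompatible_zero, and_true]
  constructor
  · rintro ⟨m, a, c⟩
    exact fun i hi => (a i hi).trans (c i (by omega))
  · exact fun a => ⟨g, a, fun i _ => rfl⟩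

theorem flip_standard (n r h h' : ℕ) : flip (standard n r h h') = standard n r h' h := by
  refine ext_compatible fun f g => ?_
  rw [compatible_flip, compatible_standard, compatible_standard]
  constructor <;> exact fun ⟨a, b, c⟩ => ⟨fun i hi => (a i hi).symm, c, b⟩

theorem standard_ne_standard {r s : ℕ} (hrs : r < s) (hs : s ≤ n) :
    standard n r 0 0 ≠ standard n s 0 0 := by
  intro h
  have : (standard n r 0 0).rel (Sum.inl ⟨r, by omega⟩) (Sum.inr ⟨r, by omega⟩) := by
    rw [h, standard_rel_inl_inr]
    exact ⟨rfl, hrs⟩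
  exact (lt_irrefl _ (standard_rel_inl_inr.1 this).2).elim

/-- For the idempotents `e` of rank `r` and `f` of rank `s`, `e * f = f * e = e` puts the local
monoid of `e` inside that of `f`. If it contained `f`, then `e * f = f` would force `e = f`. -/
theorem ncard_range_standard_lt {r s : ℕ} (hrs : r < s) (hs : s ≤ n) :
    (Set.range fun x => standard n r 0 0 * x * standard n r 0 0).ncard <
      (Set.range fun x => standard n s 0 0 * x * standard n s 0 0).ncard := by
  have h1 := standard_mul_standard_of_le (n := n) hrs.le
  have h2 : standard n s 0 0 * standard n r 0 0 = standard n r 0 0 := by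
    simpa only [flip_mul, flip_standard] using congrArg flip h1
  refine Set.ncard_lt_ncard (Set.ssubset_iff_of_subset ?_ |>.2 ⟨standard n s 0 0, ?_, ?_⟩)
    (Set.toFinite _)
  · rintro _ ⟨x, rfl⟩
    refine ⟨standard n r 0 0 * x * standard n r 0 0, ?_⟩
    change standard n s 0 0 * (standard n r 0 0 * x * standard n r 0 0) * standard n s 0 0 = _
    calc _ = (standard n s 0 0 * standard n r 0 0) * x * (standard n r 0 0 * standard n s 0 0) := by
          simp only [mul_assoc]
      _ = _ := by rw [h1, h2]
  · exact ⟨1, by simp only [mul_one, standard_mul_standard]⟩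
  · rintro ⟨x, hx⟩
    apply standard_ne_standard hrs hs
    rw [← h1]
    change standard n r 0 0 * x * standard n r 0 0 = _ at hx
    rw [← hx]
    simp only [← mul_assoc, standard_mul_standard]

/-! ### Counting right inverses -/

/-- The right inverses, over the idempotent with `r` transversals, of the standard diagram with
`h` lower hooks. -/
def rightInverses (n r h : ℕ) : Set (PartialBrauer n) :=
  {y | y * standard n r 0 0 = y ∧ standard n r 0 h * y = standard n r 0 0}

/-- Extra hooks can only merge blocks of the product, so it still contains the `r` vertical
transversals. These blocks are already full, and the idempotents on both sides leave the remaining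
outer vertices isolated. -/
theorem rightInverses_subset {r h h' : ℕ} (hh : h ≤ h') :
    rightInverses n r h ⊆ rightInverses n r h' := by
  rintro y ⟨hy, hy'⟩
  refine ⟨hy, ?_⟩
  set z := standard n r 0 h' * y with hz
  have hze : standard n r 0 0 * z * standard n r 0 0 = z := by
    rw [hz, ← mul_assoc, standard_mul_standard, mul_assoc, hy]
  have hle : ∀ f, z.Compatible f → (standard n r 0 0).Compatible f := by
    intro f hf
    rw [← hy']
    rw [← Sum.elim_comp_inl_inr f] at hf ⊢
    rw [hz, compatible_mul] at hf
    obtain ⟨m, hm, hm'⟩ := hf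
    rw [compatible_standard] at hm
    exact (compatible_mul _ _ _ _).2
      ⟨m, compatible_standard.2 ⟨hm.1, hm.2.1, hm.2.2.mono hh⟩, hm'⟩
  refine ext_compatible fun f g => ⟨hle _, fun hfg => ?_⟩
  have hf := (compatible_standard.1 hfg).1
  let m : Fin n → Bool := fun i => if (i : ℕ) < r then f i else false
  have hm : z.Compatible (Sum.elim m m) := by
    have key : ∀ x : Fin n ⊕ Fin n, ((Sum.elim Fin.val Fin.val x) < r) →
        ∀ y, z.rel x y → Sum.elim m m x = Sum.elim m m y := by
      intro x hx y hxy
      -- The block of `x` in `z` is exactly its vertical transversal.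
      have hs : z.rel x x.swap := by
        refine rel_of_compatible hle ?_
        rcases x with i | i
        · exact standard_rel_inl_inr.2 ⟨rfl, hx⟩
        · exact (standard n r 0 0).rel.symm (standard_rel_inl_inr.2 ⟨rfl, hx⟩)
      rcases z.eq_or_eq_or_eq hs hxy with h | h | h
      · rcases x with i | i <;> simp at h
      · rw [h]
      · rw [← h]
        rcases x with i | i <;> rfl
    intro x y hxy
    by_cases hx : (Sum.elim Fin.val Fin.val x) < r
    · exact key x hx y hxy
    by_cases hy : (Sum.elim Fin.val Fin.val y) < r
    · exact (key y hy x (z.rel.symm hxy)).symm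
    have hfalse : ∀ x : Fin n ⊕ Fin n,
        ¬ ((Sum.elim Fin.val Fin.val x) < r) → Sum.elim m m x = false := by
      rintro (i | i) hi <;> exact if_neg hi
    rw [hfalse x hx, hfalse y hy]
  rw [← hze, mul_assoc, compatible_mul]
  refine ⟨m, compatible_standard.2 ⟨fun i hi => (if_pos hi).symm, rowCompatible_zero,
    rowCompatible_zero⟩, ?_⟩
  rw [compatible_mul]
  exact ⟨m, hm, compatible_standard.2 ⟨fun i hi => (if_pos hi).trans (hf i hi),
    rowCompatible_zero, rowCompatible_zero⟩⟩

/-- Labels for the diagram with an upper hook from `0` to `a`, a transversal from `a + 1` to `0`,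
and vertical transversals at `1, …, r - 1`. -/
def detourLabel (n r a : ℕ) : Fin n ⊕ Fin n → ℕ × ℕ :=
  Sum.elim (fun x => if (x : ℕ) = 0 ∨ (x : ℕ) = a then (0, 0) else
    if (x : ℕ) = a + 1 then (1, 0) else if (x : ℕ) < r then (1, (x : ℕ)) else (2, (x : ℕ)))
  fun x => if (x : ℕ) < r then (1, (x : ℕ)) else (3, (x : ℕ))

/-- The diagram with an upper hook from `0` to `a`, a transversal from `a + 1` to `0`, and vertical
transversals at `1, …, r - 1`. -/
def detour (n r a : ℕ) (ha : r ≤ a) : PartialBrauer n :=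
  ofSetoid (Setoid.ker (detourLabel n r a)) (by
    rintro (x | x) (y | y) (z | z) hy hz <;>
    simp only [Setoid.ker_def, detourLabel, Sum.elim_inl, Sum.elim_inr, Sum.inl.injEq,
      Sum.inr.injEq, Fin.ext_iff, reduceCtorEq] at hy hz ⊢ <;>
    split_ifs at hy hz <;> simp only [Prod.mk.injEq] at hy hz <;> omega)

theorem detour_rel {r a : ℕ} (ha : r ≤ a) (x y : Fin n ⊕ Fin n) :
    (detour n r a ha).rel x y ↔ detourLabel n r a x = detourLabel n r a y :=
  Iff.rfl

theorem compatible_detour {r a : ℕ} (hr : 1 ≤ r) (ha : r ≤ a) (han : a + 1 < n)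
    {f g : Fin n → Bool} : (detour n r a ha).Compatible (Sum.elim f g) ↔
      f ⟨0, by omega⟩ = f ⟨a, by omega⟩ ∧ f ⟨a + 1, han⟩ = g ⟨0, by omega⟩ ∧
        ∀ i : Fin n, 1 ≤ (i : ℕ) → (i : ℕ) < r → f i = g i := by
  constructor
  · refine fun h => ⟨h (Sum.inl _) (Sum.inl _) ?_, h (Sum.inl _) (Sum.inr _) ?_,
      fun i h1 h2 => h (Sum.inl i) (Sum.inr i) ?_⟩
    · simp [detour_rel, detourLabel]
    · simp [detour_rel, detourLabel]
      omega
    · simp only [detour_rel, detourLabel, Sum.elim_inl, Sum.elim_inr]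
      split_ifs <;> simp only [Prod.mk.injEq] <;> omega
  · rintro ⟨h0, h1, h2⟩
    have lu : ∀ x y : Fin n, (detour n r a ha).rel (Sum.inl x) (Sum.inr y) → f x = g y := by
      intro x y h
      simp only [detour_rel, detourLabel, Sum.elim_inl, Sum.elim_inr] at h
      by_cases hx : (x : ℕ) = a + 1
      · obtain rfl : x = ⟨a + 1, han⟩ := Fin.ext hx
        obtain rfl : y = ⟨0, by omega⟩ := by
          split_ifs at h <;> simp only [Prod.mk.injEq, Fin.ext_iff] at h ⊢ <;> omega
        exact h1
      · obtain ⟨rfl, hx1, hx2⟩ : x = y ∧ 1 ≤ (x : ℕ) ∧ (x : ℕ) < r := by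
          rw [Fin.ext_iff]
          split_ifs at h <;> simp only [Prod.mk.injEq] at h <;> omega
        exact h2 _ hx1 hx2
    rintro (x | x) (y | y) h
    · simp only [detour_rel, detourLabel, Sum.elim_inl] at h
      have : x = y ∨ ((x : ℕ) = 0 ∧ (y : ℕ) = a) ∨ ((x : ℕ) = a ∧ (y : ℕ) = 0) := by
        rw [Fin.ext_iff]
        split_ifs at h <;> simp only [Prod.mk.injEq] at h <;> omega
      rcases this with rfl | ⟨hx, hy⟩ | ⟨hx, hy⟩
      · rfl
      · exact (congrArg f (Fin.ext hx)).trans (h0.trans (congrArg f (Fin.ext hy.symm)))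
      · exact (congrArg f (Fin.ext hx)).trans (h0.symm.trans (congrArg f (Fin.ext hy.symm)))
    · exact lu _ _ h
    · exact (lu _ _ ((detour n r a ha).rel.symm h)).symm
    · simp only [detour_rel, detourLabel, Sum.elim_inr] at h
      obtain rfl : x = y := by
        rw [Fin.ext_iff]
        split_ifs at h <;> simp only [Prod.mk.injEq] at h <;> omega
      rfl

/-- The witness is the detour with `a = r + 2 * h`: positions `a` and `a + 1` form the first lower
hook present for `h'` but absent for `h`. With it, the path `0, a, a + 1, 0'` restores the missing
transversal; without it, the path breaks at `a`. -/
theorem ncard_rightInverses_lt {r h h' : ℕ} (hr : 1 ≤ r) (hh : h < h') (hn : r + 2 * h' ≤ n) :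
    (rightInverses n r h).ncard < (rightInverses n r h').ncard := by
  have ha : r ≤ r + 2 * h := by omega
  have han : r + 2 * h + 1 < n := by omega
  refine Set.ncard_lt_ncard (Set.ssubset_iff_of_subset (rightInverses_subset hh.le) |>.2
    ⟨detour n r _ ha, ⟨?_, ?_⟩, ?_⟩) (Set.toFinite _)
  · refine ext_compatible fun f g => ?_
    simp only [compatible_mul, compatible_detour hr ha han, compatible_standard,
      rowCompatible_zero, and_true]
    constructor
    · rintro ⟨m, ⟨a, b, c⟩, d⟩
      exact ⟨a, b.trans (d _ hr), fun i h1 h2 => (c i h1 h2).trans (d i h2)⟩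
    · exact fun h => ⟨g, h, fun _ _ => rfl⟩
  · refine ext_compatible fun f g => ?_
    simp only [compatible_mul, compatible_detour hr ha han, compatible_standard,
      rowCompatible_zero, and_true, true_and]
    constructor
    · rintro ⟨m, ⟨a, b⟩, c, d, e⟩ i hi
      rcases Nat.eq_zero_or_pos (i : ℕ) with h0 | h0
      · have hi0 : i = ⟨0, by omega⟩ := Fin.ext h0
        rw [a _ hi, hi0, c, ← d]
        exact b _ _ (by simp) (by simp; omega) (by simp; omega) (by simp; omega) (by simp; omega)
      · rw [a i hi, e i h0 hi]
    · intro hfg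
      -- All positions beyond the transversals take the colour of `0`, which must travel along the
      -- detour.
      refine ⟨fun i => if (i : ℕ) < r then f i else f ⟨0, by omega⟩, ⟨?_, ?_⟩, ?_, ?_, ?_⟩
      · exact fun i hi => (if_pos hi).symm
      · intro i j h1 _ h2 _ _
        simp only [not_lt.2 h1, not_lt.2 h2, if_false]
      · simp
      · simpa [add_assoc] using hfg ⟨0, by omega⟩ hr
      · intro i _ hi
        simp only [hi, if_true]
        exact hfg i hi
  · rintro ⟨-, hy⟩
    have : (standard n r 0 h * detour n r _ ha).Compatible
        (Sum.elim (fun _ => false) fun i => decide ((i : ℕ) = 0)) := by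
      rw [compatible_mul]
      -- Only the middle vertex `a + 1`, which lies in none of the `h` hooks, is coloured `true`;
      -- this separates the upper `0` from `0'`.
      refine ⟨fun i => decide ((i : ℕ) = r + 2 * h + 1), compatible_standard.2 ⟨?_,
        rowCompatible_zero, ?_⟩, (compatible_detour hr ha han).2 ⟨?_, ?_, ?_⟩⟩
      · intro i hi
        simp
        omega
      · intro i j _ h1 _ h2 _
        have h3 : ¬ (i : ℕ) = r + 2 * h + 1 := by omega
        have h4 : ¬ (j : ℕ) = r + 2 * h + 1 := by omega
        simp [h3, h4]
      · simp
      · simp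
      · intro i h1 h2
        have h3 : ¬ (i : ℕ) = r + 2 * h + 1 := by omega
        have h4 : ¬ (i : ℕ) = 0 := by omega
        simp [h3, h4]
    rw [hy, compatible_standard] at this
    simpa using this.1 ⟨0, by omega⟩ hr

/-! ### Recovering rank and hooks from the variant -/

/-- Isomorphic variants at standard elements have equal ranks. -/
theorem rank_eq_of_variant_standard {r s h h' g g' : ℕ} (hr : r ≤ n) (hs : s ≤ n)
    (H : Nonempty (Variant (standard n r h h') ≃* Variant (standard n s g g'))) : r = s := by
  obtain ⟨φ, hφ⟩ := (nonempty_variant_mulEquiv_iff _ _).1 H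
  have key := ncard_image_congr φ (f := fun x => standard n r h h' * x * standard n r h h')
    (g := fun x => standard n s g g' * x * standard n s g g') (s := Set.univ) (t := Set.univ) (by simp)
    (sandwich_sandwich_eq_iff φ hφ)
  rw [Set.image_univ, Set.image_univ,
    ncard_range_sandwich (a := standard n r h h') (e := standard n r 0 0) (by simp only [standard_mul_standard])
      (by simp only [standard_mul_standard]),
    ncard_range_sandwich (a := standard n s g g') (e := standard n s 0 0) (by simp only [standard_mul_standard])
      (by simp only [standard_mul_standard])] at key
  rcases lt_trichotomy r s with h | h | h
  · exact absurd key (ncard_range_standard_lt h hs).ne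
  · exact h
  · exact absurd key (ncard_range_standard_lt h hr).ne'

/-- Isomorphic variants at standard elements of positive rank have equal numbers of lower hooks. -/
theorem lower_eq_of_variant_standard {r h h' g g' : ℕ} (hr : 1 ≤ r) (hn : r + 2 * h' ≤ n)
    (hn' : r + 2 * g' ≤ n)
    (H : Nonempty (Variant (standard n r h h') ≃* Variant (standard n r g g'))) : h' = g' := by
  obtain ⟨φ, hφ⟩ := (nonempty_variant_mulEquiv_iff _ _).1 H
  have key := ncard_image_congr φ (f := fun x => x * standard n r h h')
    (g := fun x => x * standard n r g g')
    (s := {x | standard n r h h' * x * standard n r h h' = standard n r h h'})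
    (t := {x | standard n r g g' * x * standard n r g g' = standard n r g g'})
    (preinverse_iff φ hφ) (sandwich_eq_iff φ hφ)
  have aux : ∀ h h', ((fun x => x * standard n r h h') ''
      {x | standard n r h h' * x * standard n r h h' = standard n r h h'}).ncard =
      (rightInverses n r h').ncard := by
    intro h h'
    rw [ncard_image_preinverse (e := standard n r 0 0) (by simp only [standard_mul_standard])
      (by simp only [standard_mul_standard]) (by simp only [standard_mul_standard])]
    simp only [standard_mul_standard, rightInverses]
  rw [aux, aux] at key
  rcases lt_trichotomy h' g' with h | h | h
  · exact absurd key (ncard_rightInverses_lt hr h hn').ne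
  · exact h
  · exact absurd key (ncard_rightInverses_lt hr h hn).ne'

/-! ### Recovering the degree -/

/-- The extension of a diagram to a larger degree by isolated vertices. -/
def extend {m n : ℕ} (ι : Fin m ⊕ Fin m ↪ Fin n ⊕ Fin n) (α : PartialBrauer m) :
    PartialBrauer n :=
  ofSetoid
    { r := fun x y => x = y ∨ ∃ a b, α.rel a b ∧ ι a = x ∧ ι b = y
      iseqv := by
        refine ⟨fun x => Or.inl rfl, ?_, ?_⟩
        · rintro x y (rfl | ⟨a, b, h, rfl, rfl⟩)
          · exact Or.inl rfl
          · exact Or.inr ⟨b, a, α.rel.symm h, rfl, rfl⟩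
        · rintro x y z (rfl | ⟨a, b, h, rfl, rfl⟩) (rfl | ⟨c, d, h', hc, rfl⟩)
          · exact Or.inl rfl
          · exact Or.inr ⟨c, d, h', hc, rfl⟩
          · exact Or.inr ⟨a, b, h, rfl, rfl⟩
          · obtain rfl := ι.injective hc
            exact Or.inr ⟨a, d, α.rel.trans h h', rfl, rfl⟩ } (by
    rintro x y z (rfl | ⟨a, b, h, rfl, rfl⟩) (rfl | ⟨c, d, h', hc, rfl⟩)
    · exact Or.inl rfl
    · exact Or.inl rfl
    · exact Or.inr (Or.inl rfl)
    · obtain rfl := ι.injective hc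
      simpa only [ι.injective.eq_iff] using α.eq_or_eq_or_eq h h')

theorem extend_rel {m n : ℕ} (ι : Fin m ⊕ Fin m ↪ Fin n ⊕ Fin n) (α : PartialBrauer m)
    (x y : Fin n ⊕ Fin n) :
    (extend ι α).rel x y ↔ x = y ∨ ∃ a b, α.rel a b ∧ ι a = x ∧ ι b = y :=
  Iff.rfl

theorem natCard_lt_natCard {m n : ℕ} (hmn : m < n) :
    Nat.card (PartialBrauer m) < Nat.card (PartialBrauer n) := by
  let κ : Fin m ↪ Fin n := Fin.castLEEmb hmn.le
  let ι : Fin m ⊕ Fin m ↪ Fin n ⊕ Fin n := κ.sumMap κ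
  have hinj : Function.Injective (extend ι) := by
    intro α β h
    have key : ∀ γ : PartialBrauer m, ∀ x y, γ.rel x y ↔ (extend ι γ).rel (ι x) (ι y) := by
      intro γ x y
      rw [extend_rel]
      constructor
      · exact fun h => Or.inr ⟨x, y, h, rfl, rfl⟩
      · rintro (h | ⟨a, b, h, ha, hb⟩)
        · rw [ι.injective h]
        · rwa [← ι.injective ha, ← ι.injective hb]
    ext x y
    rw [key, key, h]
  classical
  cases nonempty_fintype (PartialBrauer m)
  cases nonempty_fintype (PartialBrauer n)
  rw [Nat.card_eq_fintype_card, Nat.card_eq_fintype_card]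
  refine Fintype.card_lt_of_injective_not_surjective _ hinj fun hsurj => ?_
  -- The identity joins the new vertex `m` to its copy below, whereas every extension leaves it
  -- isolated.
  obtain ⟨α, hα⟩ := hsurj 1
  have h1 : (1 : PartialBrauer n).rel (Sum.inl ⟨m, hmn⟩) (Sum.inr ⟨m, hmn⟩) := rfl
  rw [← hα, extend_rel] at h1
  rcases h1 with h1 | ⟨a | a, b, -, ha, -⟩
  · simp at h1
  · have := congrArg Fin.val (Sum.inl_injective ha)
    have h2 := a.2
    simp [κ] at this
    omega
  · simp [ι] at ha

end PartialBrauer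

/-! ### Reduction to standard position -/

theorem Equiv.Perm.exists_apply_eq {X Y : Type*} [Finite Y] (s t : X ↪ Y) :
    ∃ π : Equiv.Perm Y, ∀ x, π (s x) = t x := by
  classical
  cases nonempty_fintype Y
  let e : {y // y ∈ Set.range s} ≃ {y // y ∈ Set.range t} :=
    (Equiv.ofInjective s s.injective).symm.trans (Equiv.ofInjective t t.injective)
  refine ⟨e.extendSubtype, fun x => ?_⟩
  rw [Equiv.extendSubtype_apply_of_mem e (s x) ⟨x, rfl⟩]
  simp [e]

theorem numSingletonClasses_eq {X : Type*} [Finite X] (K : Setoid X) :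
    numSingletonClasses K = {x | ∀ y, K x y → x = y}.ncard := by
  unfold numSingletonClasses
  symm
  refine Set.ncard_congr (fun x _ => {x}) ?_ ?_ ?_
  · intro x hx
    refine ⟨⟨x, ?_⟩, Set.ncard_singleton x⟩
    ext y
    simp only [Set.mem_singleton_iff, Set.mem_ofPred_eq]
    constructor
    · rintro rfl
      exact K.refl _
    · exact fun h => (hx y (K.symm h)).symm
  · exact fun x y _ _ h => Set.singleton_injective h
  · rintro b ⟨⟨x, rfl⟩, hb⟩
    obtain ⟨z, hz⟩ := Set.ncard_eq_one.1 hb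
    have hxz : x = z := by
      have : x ∈ ({z} : Set X) := hz ▸ K.refl x
      exact this
    subst hxz
    refine ⟨x, fun y hy => ?_, hz.symm⟩
    have : y ∈ ({x} : Set X) := hz ▸ K.symm hy
    exact this.symm

namespace PartialBrauer

variable {n : ℕ}

/-- An equivalence relation on a row with classes of size at most two can be put in standard
position. -/
theorem exists_perm_rowLabel {r c : ℕ} (hc : 0 < c) (K : Setoid (Fin n))
    (hK : ∀ x y z, K x y → K x z → x = y ∨ x = z ∨ y = z) (t : Fin r ↪ Fin n)
    (ht : ∀ i y, K (t i) y → t i = y) :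
    ∃ h, numSingletonClasses K + 2 * h = n ∧ r + 2 * h ≤ n ∧ ∃ π : Equiv.Perm (Fin n),
      (∀ (x : Fin n) (hx : (x : ℕ) < r), π x = t ⟨x, hx⟩) ∧
      ∀ x y, K (π x) (π y) ↔ rowLabel r h c x = rowLabel r h c y := by
  classical
  -- Each two-element class is represented by its smaller element, with `q` giving the larger one.
  let A := {x : Fin n // ∃ y, K x y ∧ x < y}
  choose q hq hq' using fun a : A => a.2
  let h := Fintype.card A
  let e : Fin h ≃ A := (Fintype.equivFin A).symm
  have hqne : ∀ a b : A, q a ≠ b := by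
    intro a b hab
    have := hK (q a) a (q b) (K.symm (hq a)) (hab ▸ hq b)
    have h1 := hq' a
    have h2 := hq' b
    rw [← hab] at h2
    rcases this with h | h | h
    · exact h1.ne h.symm
    · exact h2.ne h
    · exact (h1.trans h2).ne h
  have hqinj : ∀ a b : A, q a = q b → a = b := by
    intro a b hab
    have := hK (q a) a b (K.symm (hq a)) (K.symm (hab ▸ hq b))
    rcases this with h | h | h
    · exact absurd h (hqne a a)
    · exact absurd h (hqne a b)
    · exact Subtype.ext h
  let s₁ : Fin h × Bool → Fin n := fun p => if p.2 then q (e p.1) else (e p.1 : Fin n)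
  have hs₁ : Function.Injective s₁ := by
    rintro ⟨i, _ | _⟩ ⟨j, _ | _⟩ hij
    · have := Subtype.ext (show ((e i : A) : Fin n) = e j by simpa [s₁] using hij)
      rw [e.injective this]
    · exact absurd (show q (e j) = e i by simpa [s₁] using hij.symm) (hqne _ _)
    · exact absurd (show q (e i) = e j by simpa [s₁] using hij) (hqne _ _)
    · have := hqinj _ _ (show q (e i) = q (e j) by simpa [s₁] using hij)
      rw [e.injective this]
  have hnot : ∀ p, ∃ y, K (s₁ p) y ∧ s₁ p ≠ y := by
    rintro ⟨i, _ | _⟩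
    · exact ⟨q (e i), by simpa [s₁] using hq (e i), by simpa [s₁] using (hq' (e i)).ne⟩
    · exact ⟨e i, by simpa [s₁] using K.symm (hq (e i)), by simpa [s₁] using (hq' (e i)).ne'⟩
  let s : Fin r ⊕ (Fin h × Bool) ↪ Fin n := ⟨Sum.elim t s₁, t.injective.sumElim hs₁ (by
    intro i p hip
    obtain ⟨y, hy, hne⟩ := hnot p
    rw [← hip] at hy hne
    exact hne (ht i y hy))⟩
  have hcard : r + 2 * h ≤ n := by
    have := Fintype.card_le_of_embedding s
    simp at this
    omega
  let s₀ : Fin r ⊕ (Fin h × Bool) ↪ Fin n := ⟨Sum.elim (fun i => ⟨i, by omega⟩)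
    (fun p => ⟨r + 2 * p.1 + p.2.toNat, by have := p.2.toNat_le; omega⟩), by
      rintro (i | ⟨i, b⟩) (j | ⟨j, b'⟩) hij
      · simpa [Fin.ext_iff] using hij
      · simp at hij
        omega
      · simp at hij
        omega
      · simp only [Sum.elim_inr, Fin.mk.injEq] at hij
        have h1 := b.toNat_le
        have h2 := b'.toNat_le
        obtain rfl : i = j := Fin.ext (by omega)
        cases b <;> cases b' <;> simp at hij <;> rfl⟩
  have hs₀f : ∀ i, (s₀ (Sum.inr (i, false)) : ℕ) = r + 2 * i := fun _ => rfl
  have hs₀t : ∀ i, (s₀ (Sum.inr (i, true)) : ℕ) = r + 2 * i + 1 := fun _ => rfl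
  -- `s₀` lists the standard positions and `s` the actual vertices; the remaining vertices may be
  -- matched arbitrarily, being singletons outside the image of `t`.
  obtain ⟨π, hπ⟩ := Equiv.Perm.exists_apply_eq s₀ s
  have hcover : ∀ x y, K x y → x < y → ∃ i, x = s₁ (i, false) ∧ y = s₁ (i, true) := by
    intro x y hxy hlt
    let a : A := ⟨x, y, hxy, hlt⟩
    refine ⟨e.symm a, by simp [s₁, a], ?_⟩
    have := hK x y (q a) hxy (hq a)
    have h1 : x < q a := hq' a
    have : y = q a := by
      rcases this with h | h | h
      · exact absurd h hlt.ne
      · exact absurd h h1.ne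
      · exact h
    simpa [s₁] using this
  have hlabel : ∀ x y, K (π x) (π y) → π x < π y → rowLabel r h c x = rowLabel r h c y := by
    intro x y hxy hlt
    obtain ⟨i, hx, hy⟩ := hcover _ _ hxy hlt
    have hx' : x = s₀ (Sum.inr (i, false)) := π.injective (hx.trans (hπ (Sum.inr (i, false))).symm)
    have hy' : y = s₀ (Sum.inr (i, true)) := π.injective (hy.trans (hπ (Sum.inr (i, true))).symm)
    rw [rowLabel_eq_iff hc, hx', hy', hs₀f, hs₀t]
    have := i.2
    omega
  refine ⟨h, ?_, hcard, π, ?_, ?_⟩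
  · have hrange : {x | ∀ y, K x y → x = y} = (Set.range s₁)ᶜ := by
      ext x
      simp only [Set.mem_ofPred_eq, Set.mem_compl_iff, Set.mem_range, not_exists]
      constructor
      · rintro hx p rfl
        obtain ⟨y, hy, hne⟩ := hnot p
        exact hne (hx y hy)
      · intro hx y hxy
        rcases lt_trichotomy x y with hlt | heq | hlt
        · obtain ⟨i, h1, -⟩ := hcover x y hxy hlt
          exact absurd h1.symm (hx _)
        · exact heq
        · obtain ⟨i, -, h1⟩ := hcover y x (K.symm hxy) hlt
          exact absurd h1.symm (hx _)
    have hcr : (Set.range s₁).ncard = 2 * h := by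
      rw [← Set.image_univ, Set.ncard_image_of_injective _ hs₁, Set.ncard_univ]
      simp [mul_comm]
    have := Set.ncard_add_ncard_compl (Set.range s₁)
    rw [hcr, Nat.card_eq_fintype_card, Fintype.card_fin] at this
    rw [numSingletonClasses_eq, hrange]
    omega
  · intro x hx
    exact hπ (Sum.inl ⟨x, hx⟩)
  · intro x y
    constructor
    · intro hxy
      rcases lt_trichotomy (π x) (π y) with hlt | heq | hlt
      · exact hlabel x y hxy hlt
      · rw [π.injective heq]
      · exact (hlabel y x (K.symm hxy) hlt).symm
    · rw [rowLabel_eq_iff hc]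
      rintro (hxy | ⟨h1, h2, h3, h4, h5⟩)
      · rw [Fin.ext hxy]
      -- Both positions of the `j`-th standard hook are sent into the class of the `j`-th element of
      -- `A`.
      · have key : ∀ x : Fin n, ∀ hj : ((x : ℕ) - r) / 2 < h, r ≤ x →
            K (π x) (e ⟨((x : ℕ) - r) / 2, hj⟩) := by
          intro x hj hx
          set j : Fin h := ⟨((x : ℕ) - r) / 2, hj⟩ with hjdef
          rcases Nat.mod_two_eq_zero_or_one ((x : ℕ) - r) with hm | hm
          · have hx' : x = s₀ (Sum.inr (j, false)) := by
              rw [Fin.ext_iff, hs₀f]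
              simp only [hjdef]
              omega
            rw [hx', hπ]
            simp [s, s₁]
          · have hx' : x = s₀ (Sum.inr (j, true)) := by
              rw [Fin.ext_iff, hs₀t]
              simp only [hjdef]
              omega
            rw [hx', hπ]
            simpa [s, s₁] using K.symm (hq (e j))
        have hx := key x (by omega) h1
        have hy := key y (by omega) h3
        simp only [← h5] at hy
        exact K.trans hx (K.symm hy)

/-- A common indexing of upper and lower ends is what lets two independent row renamings make all
transversals vertical. -/
theorem exists_transversals (α : PartialBrauer n) : ∃ t b : Fin α.rank ↪ Fin n,
    ∀ x y, α.rel (Sum.inl x) (Sum.inr y) ↔ ∃ i, x = t i ∧ y = b i := by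
  let B := {b ∈ α.rel.classes | (∃ i, Sum.inl i ∈ b) ∧ (∃ j, Sum.inr j ∈ b)}
  have e : Fin α.rank ≃ B := (Finite.equivFinOfCardEq rfl).symm
  choose t ht using fun b : B => b.2.2.1
  choose l hl using fun b : B => b.2.2.2
  have hrel : ∀ (b : B) {x y}, x ∈ (b : Set (Fin n ⊕ Fin n)) → y ∈ (b : Set (Fin n ⊕ Fin n)) →
      α.rel x y := fun b x y hx hy => (α.rel.rel_iff_exists_classes).2 ⟨b, b.2.1, hx, hy⟩
  have huniq : ∀ (b b' : B) {x}, x ∈ (b : Set (Fin n ⊕ Fin n)) →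
      x ∈ (b' : Set (Fin n ⊕ Fin n)) → b = b' := fun b b' x hx hx' =>
    Subtype.ext (Setoid.eq_of_mem_classes b.2.1 hx b'.2.1 hx')
  refine ⟨⟨fun i => t (e i), fun i j hij => e.injective (huniq _ _ (ht (e i)) ?_)⟩,
    ⟨fun i => l (e i), fun i j hij => e.injective (huniq _ _ (hl (e i)) ?_)⟩, fun x y => ⟨?_, ?_⟩⟩
  · simp only at hij
    rw [hij]
    exact ht _
  · simp only at hij
    rw [hij]
    exact hl _
  · intro hxy
    obtain ⟨c, hc, hx, hy⟩ := (α.rel.rel_iff_exists_classes).1 hxy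
    let b : B := ⟨c, hc, ⟨x, hx⟩, ⟨y, hy⟩⟩
    refine ⟨e.symm b, ?_, ?_⟩
    · change x = t (e (e.symm b))
      rw [e.apply_symm_apply]
      have h1 : α.rel (Sum.inl x) (Sum.inl (t b)) := hrel b hx (ht b)
      rcases α.eq_or_eq_or_eq hxy h1 with h | h | h
      · simp at h
      · simpa using h
      · simp at h
    · change y = l (e (e.symm b))
      rw [e.apply_symm_apply]
      have h1 : α.rel (Sum.inr y) (Sum.inr (l b)) := hrel b hy (hl b)
      rcases α.eq_or_eq_or_eq (α.rel.symm hxy) h1 with h | h | h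
      · simp at h
      · simpa using h
      · simp at h
  · rintro ⟨i, rfl, rfl⟩
    exact hrel (e i) (ht _) (hl _)

/-- Every diagram can be put in standard position by renaming its vertices. -/
theorem exists_relabel_eq_standard (α : PartialBrauer n) : ∃ h h',
    numSingletonClasses α.ker + 2 * h = n ∧ numSingletonClasses α.coker + 2 * h' = n ∧
      α.rank + 2 * h ≤ n ∧ α.rank + 2 * h' ≤ n ∧
      ∃ π ρ, relabel π ρ α = standard n α.rank h h' := by
  obtain ⟨t, b, htb⟩ := α.exists_transversals
  have hrel : ∀ i, α.rel (Sum.inl (t i)) (Sum.inr (b i)) := fun i => (htb _ _).2 ⟨i, rfl, rfl⟩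
  obtain ⟨h, h1, h2, π, h3, h4⟩ := exists_perm_rowLabel (c := 1) one_pos α.ker
    (fun x y z hy hz => by simpa using α.eq_or_eq_or_eq (x := Sum.inl x) hy hz) t
    (fun i y hy => by simpa using α.eq_or_eq_or_eq (hrel i) (z := Sum.inl y) hy)
  obtain ⟨h', h1', h2', ρ, h3', h4'⟩ := exists_perm_rowLabel (c := 3) (by norm_num) α.coker
    (fun x y z hy hz => by simpa using α.eq_or_eq_or_eq (x := Sum.inr x) hy hz) b
    (fun i y hy => by
      simpa using α.eq_or_eq_or_eq (α.rel.symm (hrel i)) (z := Sum.inr y) hy)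
  refine ⟨h, h', h1, h1', h2, h2', π, ρ, ?_⟩
  have key : ∀ x y, α.rel (Sum.inl (π x)) (Sum.inr (ρ y)) ↔ x = y ∧ (x : ℕ) < α.rank := by
    intro x y
    rw [htb]
    constructor
    · rintro ⟨i, hx, hy⟩
      have hi : (i : ℕ) < n := by omega
      have hx' : x = ⟨i, hi⟩ := π.injective (hx.trans (h3 ⟨i, hi⟩ i.2).symm)
      have hy' : y = ⟨i, hi⟩ := ρ.injective (hy.trans (h3' ⟨i, hi⟩ i.2).symm)
      exact ⟨hx'.trans hy'.symm, by rw [hx']; exact i.2⟩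
    · rintro ⟨rfl, hx⟩
      exact ⟨⟨x, hx⟩, h3 x hx, h3' x hx⟩
  ext x y
  rcases x with x | x <;> rcases y with y | y
  · exact h4 x y
  · exact (key x y).trans standard_rel_inl_inr.symm
  · rw [Setoid.comm', Setoid.comm' (standard n α.rank h h').rel]
    exact (key y x).trans standard_rel_inl_inr.symm
  · exact h4' x y

end PartialBrauer

/-! ### The classification -/

open PartialBrauer in
theorem theoremt (m n : ℕ) (α : PartialBrauer m) (β : PartialBrauer n)
    (hα : 1 ≤ α.rank) (hβ : 1 ≤ β.rank) :
    Nonempty (Variant α ≃* Variant β) ↔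
      m = n ∧ numSingletonClasses α.ker = numSingletonClasses β.ker ∧
        numSingletonClasses α.coker = numSingletonClasses β.coker ∧ α.rank = β.rank := by
  obtain ⟨h, h', hk, hp, hr, hr', π, ρ, hst⟩ := α.exists_relabel_eq_standard
  obtain ⟨g, g', hl, hw, hs, hs', π', ρ', hst'⟩ := β.exists_relabel_eq_standard
  obtain ⟨eα⟩ := nonempty_variant_relabel π ρ α
  obtain ⟨eβ⟩ := nonempty_variant_relabel π' ρ' β
  rw [hst] at eα
  rw [hst'] at eβ
  constructor
  · rintro ⟨φ⟩
    have hmn : m = n := by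
      have hcard : Nat.card (PartialBrauer m) = Nat.card (PartialBrauer n) :=
        Nat.card_congr φ.toEquiv
      rcases lt_trichotomy m n with hlt | heq | hlt
      · exact absurd hcard (natCard_lt_natCard hlt).ne
      · exact heq
      · exact absurd hcard (natCard_lt_natCard hlt).ne'
    subst hmn
    have ψ := (eα.symm.trans φ).trans eβ
    have hrs : α.rank = β.rank := rank_eq_of_variant_standard (by omega) (by omega) ⟨ψ⟩
    rw [← hrs] at ψ hs hs'
    have h1 := lower_eq_of_variant_standard hα hr' hs' ⟨ψ⟩
    -- Flipping turns upper hooks into lower hooks, so the same count applies to `h` and `g`.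
    have h2 := nonempty_variant_flip ⟨ψ⟩
    rw [flip_standard, flip_standard] at h2
    have h3 := lower_eq_of_variant_standard hα hr hs h2
    exact ⟨rfl, by omega, by omega, hrs⟩
  · rintro ⟨rfl, h1, h2, h3⟩
    obtain rfl : h = g := by omega
    obtain rfl : h' = g' := by omega
    rw [← h3] at eβ
    exact ⟨eα.trans eβ.symm⟩
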